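/- Let $\mathbb{F}_q$ be a finite field of odd characteristic and let $K=\mathbb{F}_q(t)$. For every integer $d\geq 1$, let $E_d$ be the elliptic curve over $K$ given by the Weierstrass equation $$E_d:\quad y^2=x\cdot\big(x^2+t^{2d}\cdot x-4t^{2d}\big).$$ Then the point $P_d=(2t^d,\,2t^{2d})\in E_d(K)$ has infinite order. In particular, the Mordell--Weil group $E_d(K)$ has positive rank. -/

import Mathlib

noncomputable section

/-- The Weierstrass curve `E_d : y² = x (x² + t^{2d} x - 4 t^{2d})` over the rational function
field `K = F(t)`, where `t = RatFunc.X`. -/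
def curveE (F : Type*) [Field F] (d : ℕ) : WeierstrassCurve (RatFunc F) where
  a₁ := 0
  a₂ := RatFunc.X ^ (2 * d)
  a₃ := 0
  a₄ := -4 * RatFunc.X ^ (2 * d)
  a₆ := 0

theorem ratFunc_two_ne_zero {F : Type*} [Field F] (hF : ringChar F ≠ 2) :
    (2 : RatFunc F) ≠ 0 := by
  have h : (2 : F) ≠ 0 := Ring.two_ne_zero hF
  have h' := (map_ne_zero (RatFunc.C (K := F))).mpr h
  rwa [map_ofNat] at h'

theorem curveE_discr (F : Type*) [Field F] (d : ℕ) :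
    (curveE F d).Δ = 2 ^ 8 * RatFunc.X ^ (6 * d) * (RatFunc.X ^ (2 * d) + 16) := by
  simp only [curveE, WeierstrassCurve.Δ, WeierstrassCurve.b₂, WeierstrassCurve.b₄,
    WeierstrassCurve.b₆, WeierstrassCurve.b₈]
  ring

/-- In characteristic different from `2` and for `d ≥ 1`, the curve `E_d` is an elliptic curve. -/
theorem curveE_isElliptic {F : Type*} [Field F] (hF : ringChar F ≠ 2) {d : ℕ} (hd : 1 ≤ d) :
    (curveE F d).IsElliptic := by
  refine ⟨isUnit_iff_ne_zero.mpr ?_⟩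
  rw [curveE_discr]
  refine mul_ne_zero (mul_ne_zero (pow_ne_zero _ (ratFunc_two_ne_zero hF))
    (pow_ne_zero _ RatFunc.X_ne_zero)) ?_
  have h : (Polynomial.X ^ (2 * d) + Polynomial.C (16 : F)) ≠ 0 :=
    Polynomial.X_pow_add_C_ne_zero (by omega) _
  have h' := (map_ne_zero_iff _ (RatFunc.algebraMap_injective F)).mpr h
  rwa [map_add, map_pow, RatFunc.algebraMap_X, RatFunc.algebraMap_C, map_ofNat] at h'

/-- The coordinates of `P_d` define a (nonsingular) point of the affine model of `E_d`. -/
theorem pointP_nonsingular {F : Type*} [Field F] (hF : ringChar F ≠ 2) {d : ℕ} (hd : 1 ≤ d) :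
    (curveE F d).toAffine.Nonsingular (2 * RatFunc.X ^ d) (2 * RatFunc.X ^ (2 * d)) := by
  have := curveE_isElliptic hF hd
  rw [← WeierstrassCurve.Affine.equation_iff_nonsingular,
    WeierstrassCurve.Affine.equation_iff]
  simp only [curveE]
  ring

/-- The point `P_d = (2 t^d, 2 t^{2d})` of `E_d(K)`, `K = F(t)`. -/
def pointP {F : Type*} [Field F] (hF : ringChar F ≠ 2) {d : ℕ} (hd : 1 ≤ d) :
    (curveE F d).toAffine.Point :=
  .some (2 * RatFunc.X ^ d) (2 * RatFunc.X ^ (2 * d)) (pointP_nonsingular hF hd)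

end

/-!
At each place of `K` the points of `E_d` with nonsingular reduction form a subgroup, and on the
points that reduce nonsingularly everywhere the numerator and denominator produced by the
duplication formula have no common factor. Hence doubling such a point multiplies the naive height
of its `x`-coordinate by exactly `4`, and the point cannot be torsion unless this height is zero.
The point `P_d` itself meets the cusp above `t = 0`, and both `P_d` and `2 P_d` meet the node at
`t = ∞`; but `x(2 P_d) = 4` and `x(4 P_d) = (t ^ (2 d) + 4) ^ 2 / 16`, so `4 P_d` is such a point
and has positive height.
-/

open Polynomial WeierstrassCurve

theorem not_isOfFinAddOrder_of_lt_two_nsmul {A : Type*} [AddMonoid A] (S : Set A) (height : A → ℕ)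
    (hS : ∀ Q ∈ S, 2 • Q ∈ S ∧ height Q < height (2 • Q)) {Q : A} (hQ : Q ∈ S) :
    ¬ IsOfFinAddOrder Q := by
  have mem_S (k : ℕ) : 2 ^ k • Q ∈ S := by
    induction k with
    | zero => simpa using hQ
    | succ k ih => simpa only [pow_succ, mul_nsmul] using (hS _ ih).1
  have height_strictMono : StrictMono fun k : ℕ ↦ height (2 ^ k • Q) := by
    refine strictMono_nat_of_lt_succ fun k ↦ ?_
    simpa only [pow_succ, mul_nsmul] using (hS _ (mem_S k)).2
  intro hfin
  exact Set.infinite_of_injective_forall_mem (f := fun k : ℕ ↦ 2 ^ k • Q)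
    (fun j k hjk ↦ height_strictMono.injective (congrArg height hjk))
    (fun k ↦ (AddSubmonoid.mem_multiples_iff _ _).mpr ⟨_, rfl⟩) hfin.finite_multiples

theorem rank_int_pos_of_not_isOfFinAddOrder {A : Type*} [AddCommGroup A] {Q : A}
    (hQ : ¬ IsOfFinAddOrder Q) : 0 < Module.rank ℤ A := by
  refine pos_iff_ne_zero.mpr fun h ↦ hQ ?_
  obtain ⟨n, hn, hnQ⟩ := rank_eq_zero_iff.mp h Q
  exact isOfFinAddOrder_iff_zsmul_eq_zero.mpr ⟨n, hn, hnQ⟩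

section XCoord

variable {K : Type*} [Field K] {W : Affine K}

/-- `Q` is an affine point with `x`-coordinate `x`. Phrasing this as a predicate lets one speak of
`x`-coordinates without naming the `y`-coordinate and without a junk value at infinity. -/
def HasXCoord (Q : W.Point) (x : K) : Prop :=
  ∃ y h, Q = .some x y h

theorem HasXCoord.two_nsmul [DecidableEq K] {Q : W.Point} {x : K} (hQ : HasXCoord Q x)
    (hx : 4 * x ^ 3 + W.b₂ * x ^ 2 + 2 * W.b₄ * x + W.b₆ ≠ 0) :
    HasXCoord (2 • Q) ((x ^ 4 - W.b₄ * x ^ 2 - 2 * W.b₆ * x - W.b₈) /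
      (4 * x ^ 3 + W.b₂ * x ^ 2 + 2 * W.b₄ * x + W.b₆)) := by
  obtain ⟨y, hxy, rfl⟩ := hQ
  have heq := (Affine.equation_iff _ _).mp hxy.1
  have hsq : 4 * x ^ 3 + W.b₂ * x ^ 2 + 2 * W.b₄ * x + W.b₆ = (y - W.negY x y) ^ 2 := by
    simp only [b₂, b₄, b₆, Affine.negY]
    linear_combination -4 * heq
  rw [hsq] at hx ⊢
  have hsub : y - W.negY x y ≠ 0 := pow_ne_zero_iff two_ne_zero |>.mp hx
  have hne : y ≠ W.negY x y := sub_ne_zero.mp hsub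
  have haddX : W.addX x x (W.slope x x y y) =
      (x ^ 4 - W.b₄ * x ^ 2 - 2 * W.b₆ * x - W.b₈) / (y - W.negY x y) ^ 2 := by
    rw [Affine.slope_of_Y_ne rfl hne, Affine.addX, eq_div_iff hx]
    field_simp
    simp only [b₄, b₆, b₈, Affine.negY]
    linear_combination -(W.a₁ ^ 2 + 4 * W.a₂ + 8 * x) * heq
  rw [_root_.two_nsmul, Affine.Point.add_self_of_Y_ne hne, ← haddX]
  exact ⟨_, _, rfl⟩

end XCoord

section NaiveHeight

variable {F : Type*} [Field F]

/-- The naive (logarithmic) height of a rational function. -/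
noncomputable def naiveHeight (x : RatFunc F) : ℕ :=
  max x.num.natDegree x.denom.natDegree

theorem naiveHeight_div {a b : F[X]} (hab : IsCoprime a b) (hb : b ≠ 0) :
    naiveHeight (algebraMap F[X] (RatFunc F) a / algebraMap F[X] (RatFunc F) b) =
      max a.natDegree b.natDegree := by
  set x : RatFunc F := algebraMap F[X] (RatFunc F) a / algebraMap F[X] (RatFunc F) b with hx
  have hcross : x.num * b = a * x.denom := (RatFunc.num_mul_eq_mul_denom_iff hb).mpr hx
  have hcop := RatFunc.isCoprime_num_denom x
  have hnum : Associated x.num a := associated_of_dvd_dvd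
    (hcop.dvd_of_dvd_mul_right (hcross ▸ dvd_mul_right _ _))
    (hab.dvd_of_dvd_mul_right (hcross ▸ dvd_mul_right _ _))
  have hdenom : Associated x.denom b := associated_of_dvd_dvd
    (hcop.symm.dvd_of_dvd_mul_left (hcross ▸ dvd_mul_left _ _))
    (hab.symm.dvd_of_dvd_mul_left (hcross ▸ dvd_mul_left _ _))
  rw [naiveHeight, natDegree_eq_of_degree_eq (degree_eq_degree_of_associated hnum),
    natDegree_eq_of_degree_eq (degree_eq_degree_of_associated hdenom)]

/-- The naive height of a point of a Weierstrass curve over `F(t)`, i.e. the height of its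
`x`-coordinate, or `0` at infinity. -/
noncomputable def xHeight {W : Affine (RatFunc F)} : W.Point → ℕ
  | .zero => 0
  | .some x _ _ => naiveHeight x

theorem HasXCoord.xHeight_eq {W : Affine (RatFunc F)} {Q : W.Point} {x : RatFunc F}
    (hQ : HasXCoord Q x) : xHeight Q = naiveHeight x := by
  obtain ⟨y, h, rfl⟩ := hQ
  rfl

end NaiveHeight

section Duplication

variable {R : Type*} [CommRing R]

/-- The numerator of the homogeneous duplication map `a / b ↦ x(2 Q)`, where `x(Q) = a / b` and `Q`
lies on `y ^ 2 = x * (x ^ 2 + w * x - 4 * w)`. -/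
def duplicationNum (w a b : R) : R :=
  (a ^ 2 + 4 * w * b ^ 2) ^ 2

/-- The denominator of the homogeneous duplication map on `y ^ 2 = x * (x ^ 2 + w * x - 4 * w)`;
see `duplicationNum`. -/
def duplicationDenom (w a b : R) : R :=
  4 * a * b * (a ^ 2 + w * a * b - 4 * w * b ^ 2)

theorem map_duplicationNum {S : Type*} [CommRing S] (f : R →+* S) (w a b : R) :
    f (duplicationNum w a b) = duplicationNum (f w) (f a) (f b) := by
  simp only [duplicationNum, map_mul, map_pow, map_add, map_ofNat]

theorem map_duplicationDenom {S : Type*} [CommRing S] (f : R →+* S) (w a b : R) :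
    f (duplicationDenom w a b) = duplicationDenom (f w) (f a) (f b) := by
  simp only [duplicationDenom, map_mul, map_pow, map_add, map_sub, map_ofNat]

/-- The fraction `a / b` is reduced and, modulo every prime of a ring in which `2` is invertible, is
not the `x`-coordinate of a singular point of `y ^ 2 = x * (x ^ 2 + w * x - 4 * w)`. The
discriminant is `2 ^ 8 * w ^ 3 * (w + 16)`: modulo `w` there is a cusp at `x = 0`, and modulo
`w + 16` the cubic is `x * (x - 8) ^ 2`, with a node at `x = 8`. -/
structure IsNonsingularFraction (w a b : R) : Prop where
  isCoprime : IsCoprime a b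
  isCoprime_cusp : IsCoprime a w
  isCoprime_node : IsCoprime (a - 8 * b) (w + 16)

theorem isCoprime_add_four_mul_of_isCoprime {w a : R} (b : R) (h : IsCoprime a w) :
    IsCoprime (a ^ 2 + 4 * w * b ^ 2) w := by
  rw [show a ^ 2 + 4 * w * b ^ 2 = a ^ 2 + w * (4 * b ^ 2) by ring]
  exact h.pow_left.add_mul_left_left _

theorem IsNonsingularFraction.isCoprime_duplication (h2 : IsUnit (2 : R)) {w a b : R}
    (h : IsNonsingularFraction w a b) :
    IsCoprime (duplicationNum w a b) (duplicationDenom w a b) := by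
  obtain ⟨hab, haw, hnode⟩ := h
  have h4 : IsUnit (4 : R) := by simpa only [show (4 : R) = 2 ^ 2 by norm_num] using h2.pow 2
  have four_isCoprime (z : R) : IsCoprime 4 z := isCoprime_one_left.of_isCoprime_of_dvd_left h4.dvd
  set n := a ^ 2 + 4 * w * b ^ 2 with hn
  have hna : IsCoprime n a := by
    rw [show n = 4 * w * b ^ 2 + a * a by rw [hn]; ring]
    exact (((four_isCoprime a).mul_left haw.symm).mul_left hab.symm.pow_left).add_mul_left_left a
  have hnb : IsCoprime n b := by
    rw [show n = a ^ 2 + b * (4 * w * b) by rw [hn]; ring]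
    exact hab.pow_left.add_mul_left_left _
  have hnw : IsCoprime n w := isCoprime_add_four_mul_of_isCoprime b haw
  have hnnode : IsCoprime n (a - 8 * b) := by
    have hb : IsCoprime b (a - 8 * b) := by
      rw [show a - 8 * b = a + b * (-8) by ring]
      exact (hab.add_mul_left_left _).symm
    rw [show n = 4 * b ^ 2 * (w + 16) + (a - 8 * b) * (a + 8 * b) by rw [hn]; ring]
    exact (((four_isCoprime _).mul_left hb.pow_left).mul_left hnode.symm).add_mul_left_left _
  have hncubic : IsCoprime n (a ^ 2 + w * a * b - 4 * w * b ^ 2) := by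
    rw [show a ^ 2 + w * a * b - 4 * w * b ^ 2 = w * b * (a - 8 * b) + n * 1 by rw [hn]; ring]
    exact ((hnw.mul_right hnb).mul_right hnnode).symm.add_mul_left_left 1 |>.symm
  exact ((((four_isCoprime n).symm.mul_right hna).mul_right hnb).mul_right hncubic).pow_left

theorem IsNonsingularFraction.duplication (h2 : IsUnit (2 : R)) {w a b : R}
    (h : IsNonsingularFraction w a b) :
    IsNonsingularFraction w (duplicationNum w a b) (duplicationDenom w a b) where
  isCoprime := h.isCoprime_duplication h2
  isCoprime_cusp := (isCoprime_add_four_mul_of_isCoprime b h.isCoprime_cusp).pow_left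
  isCoprime_node := by
    rw [show duplicationNum w a b - 8 * duplicationDenom w a b = (a - 8 * b) ^ 4 + (w + 16) *
      (-24 * a ^ 2 * b ^ 2 + 128 * a * b ^ 3 + 16 * (w - 16) * b ^ 4) by
        simp only [duplicationNum, duplicationDenom]; ring]
    exact h.isCoprime_node.pow_left.add_mul_left_left _

end Duplication

section Degree

variable {R : Type*} [CommRing R] {w a b : R[X]}

theorem natDegree_four_mul_mul_sq_le (w b : R[X]) :
    (4 * w * b ^ 2).natDegree ≤ w.natDegree + 2 * b.natDegree := by
  simpa only [zero_add] using natDegree_mul_le_of_le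
    (natDegree_mul_le_of_le (natDegree_ofNat 4).le le_rfl) natDegree_pow_le

theorem natDegree_duplicationDenom_le (h : b.natDegree + w.natDegree < a.natDegree) :
    (duplicationDenom w a b).natDegree ≤ 3 * a.natDegree + b.natDegree := by
  have hmid : (w * a * b).natDegree ≤ 2 * a.natDegree :=
    (natDegree_mul_le_of_le natDegree_mul_le le_rfl).trans (by lia)
  have hlast : (4 * w * b ^ 2).natDegree ≤ 2 * a.natDegree :=
    (natDegree_four_mul_mul_sq_le w b).trans (by lia)
  have hcubic : (a ^ 2 + w * a * b - 4 * w * b ^ 2).natDegree ≤ 2 * a.natDegree :=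
    natDegree_sub_le_of_le (natDegree_add_le_of_le natDegree_pow_le hmid) hlast |>.trans (by simp)
  have hfactor : (4 * a * b).natDegree ≤ 0 + a.natDegree + b.natDegree :=
    natDegree_mul_le_of_le (natDegree_mul_le_of_le (natDegree_ofNat 4).le le_rfl) le_rfl
  exact (natDegree_mul_le_of_le hfactor hcubic).trans (by lia)

variable [NoZeroDivisors R]

theorem natDegree_duplicationNum (h : b.natDegree + w.natDegree < a.natDegree) :
    (duplicationNum w a b).natDegree = 4 * a.natDegree := by
  have hlt : (4 * w * b ^ 2).natDegree < (a ^ 2).natDegree := by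
    rw [natDegree_pow]
    exact (natDegree_four_mul_mul_sq_le w b).trans_lt (by lia)
  rw [duplicationNum, natDegree_pow, natDegree_add_eq_left_of_natDegree_lt hlt, natDegree_pow]
  ring

theorem ne_zero_of_isCoprime_of_natDegree_pos (hab : IsCoprime a b) (ha : 0 < a.natDegree) :
    b ≠ 0 := by
  rintro rfl
  exact ha.ne' (natDegree_eq_zero_of_isUnit (isCoprime_zero_right.mp hab))

end Degree

section CurveE

variable {F : Type*} [Field F] {d : ℕ}

theorem HasXCoord.two_nsmul_curveE [DecidableEq (RatFunc F)] {Q : (curveE F d).toAffine.Point}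
    {a b : RatFunc F} (hQ : HasXCoord Q (a / b))
    (hab : duplicationDenom (RatFunc.X ^ (2 * d)) a b ≠ 0) :
    HasXCoord (2 • Q) (duplicationNum (RatFunc.X ^ (2 * d)) a b /
      duplicationDenom (RatFunc.X ^ (2 * d)) a b) := by
  have hb : b ≠ 0 := by
    rintro rfl
    simp [duplicationDenom] at hab
  have hnum : duplicationNum (RatFunc.X ^ (2 * d)) a b = b ^ 4 * ((a / b) ^ 4 -
      (curveE F d).b₄ * (a / b) ^ 2 - 2 * (curveE F d).b₆ * (a / b) - (curveE F d).b₈) := by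
    simp only [duplicationNum, curveE, b₄, b₆, b₈]
    field_simp
    ring
  have hdenom : duplicationDenom (RatFunc.X ^ (2 * d)) a b = b ^ 4 * (4 * (a / b) ^ 3 +
      (curveE F d).b₂ * (a / b) ^ 2 + 2 * (curveE F d).b₄ * (a / b) + (curveE F d).b₆) := by
    simp only [duplicationDenom, curveE, b₂, b₄, b₆]
    field_simp
    ring
  rw [hdenom] at hab
  rw [hnum, hdenom, mul_div_mul_left _ _ (pow_ne_zero 4 hb)]
  exact hQ.two_nsmul (right_ne_zero_of_mul hab)

/-- The point `Q` of `E_d` has nonsingular reduction at every finite place of `F(t)`, and reduces to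
the point at infinity at the infinite place. In the coordinate `x / t ^ (2 * d)`, which is the one
adapted to the infinite place, the latter means that there is a pole. -/
def ReducesNonsingularly (Q : (curveE F d).toAffine.Point) : Prop :=
  ∃ a b : F[X], IsNonsingularFraction (X ^ (2 * d)) a b ∧
    b.natDegree + (X ^ (2 * d) : F[X]).natDegree < a.natDegree ∧
    HasXCoord Q (algebraMap F[X] (RatFunc F) a / algebraMap F[X] (RatFunc F) b)

theorem isUnit_two_polynomial (hF : ringChar F ≠ 2) : IsUnit (2 : F[X]) := by
  simpa only [map_ofNat] using isUnit_C.mpr (Ring.two_ne_zero hF).isUnit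

theorem ReducesNonsingularly.two_nsmul [DecidableEq (RatFunc F)] (hF : ringChar F ≠ 2)
    {Q : (curveE F d).toAffine.Point} (hQ : ReducesNonsingularly Q) :
    ReducesNonsingularly (2 • Q) ∧ xHeight Q < xHeight (2 • Q) := by
  obtain ⟨a, b, hab, hdeg, hx⟩ := hQ
  have hab' := hab.duplication (isUnit_two_polynomial hF)
  have hnum := natDegree_duplicationNum hdeg
  have hdenom := natDegree_duplicationDenom_le hdeg
  have hb : b ≠ 0 := ne_zero_of_isCoprime_of_natDegree_pos hab.isCoprime (by lia)
  have hb' := ne_zero_of_isCoprime_of_natDegree_pos hab'.isCoprime (by lia)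
  have hx' : HasXCoord (2 • Q) (algebraMap F[X] (RatFunc F) (duplicationNum (X ^ (2 * d)) a b) /
      algebraMap F[X] (RatFunc F) (duplicationDenom (X ^ (2 * d)) a b)) := by
    have hne := RatFunc.algebraMap_ne_zero hb'
    rw [map_duplicationDenom, map_pow, RatFunc.algebraMap_X] at hne ⊢
    rw [map_duplicationNum, map_pow, RatFunc.algebraMap_X]
    exact hx.two_nsmul_curveE hne
  refine ⟨⟨_, _, hab', by lia, hx'⟩, ?_⟩
  rw [hx.xHeight_eq, hx'.xHeight_eq, naiveHeight_div hab.isCoprime hb,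
    naiveHeight_div hab'.isCoprime hb']
  lia

theorem hasXCoord_two_nsmul_pointP [DecidableEq (RatFunc F)] (hF : ringChar F ≠ 2) (hd : 1 ≤ d) :
    HasXCoord (2 • pointP hF hd) 4 := by
  have hP : HasXCoord (pointP hF hd) (2 * RatFunc.X ^ d / 1) := by
    rw [div_one]
    exact ⟨_, _, rfl⟩
  have hnum : duplicationNum (RatFunc.X ^ (2 * d)) (2 * RatFunc.X ^ d) (1 : RatFunc F) =
      4 * (2 ^ 4 * RatFunc.X ^ (4 * d)) := by
    simp only [duplicationNum]
    ring
  have hdenom : duplicationDenom (RatFunc.X ^ (2 * d)) (2 * RatFunc.X ^ d) (1 : RatFunc F) =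
      2 ^ 4 * RatFunc.X ^ (4 * d) := by
    simp only [duplicationDenom]
    ring
  have hne : (2 ^ 4 * RatFunc.X ^ (4 * d) : RatFunc F) ≠ 0 :=
    mul_ne_zero (pow_ne_zero _ (ratFunc_two_ne_zero hF)) (pow_ne_zero _ RatFunc.X_ne_zero)
  have h2P := hP.two_nsmul_curveE (hdenom ▸ hne)
  rwa [hnum, hdenom, mul_div_cancel_right₀ _ hne] at h2P

theorem hasXCoord_four_nsmul_pointP [DecidableEq (RatFunc F)] (hF : ringChar F ≠ 2) (hd : 1 ≤ d) :
    HasXCoord (4 • pointP hF hd) ((RatFunc.X ^ (2 * d) + 4) ^ 2 / 2 ^ 4) := by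
  have hnum : duplicationNum (RatFunc.X ^ (2 * d)) (4 : RatFunc F) 1 =
      2 ^ 4 * (RatFunc.X ^ (2 * d) + 4) ^ 2 := by
    simp only [duplicationNum]
    ring
  have hdenom : duplicationDenom (RatFunc.X ^ (2 * d)) (4 : RatFunc F) 1 = 2 ^ 4 * 2 ^ 4 := by
    simp only [duplicationDenom]
    ring
  have h2 : (2 ^ 4 : RatFunc F) ≠ 0 := pow_ne_zero _ (ratFunc_two_ne_zero hF)
  have h2P : HasXCoord (2 • pointP hF hd) (4 / 1) := by
    rw [div_one]
    exact hasXCoord_two_nsmul_pointP hF hd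
  have h4P := h2P.two_nsmul_curveE (hdenom ▸ mul_ne_zero h2 h2)
  rwa [hnum, hdenom, mul_div_mul_left _ _ h2, ← mul_nsmul] at h4P

theorem reducesNonsingularly_four_nsmul_pointP [DecidableEq (RatFunc F)] (hF : ringChar F ≠ 2)
    (hd : 1 ≤ d) : ReducesNonsingularly (4 • pointP hF hd) := by
  have h16 : IsUnit (2 ^ 4 : F[X]) := (isUnit_two_polynomial hF).pow 4
  have isCoprime_sixteen (z : F[X]) : IsCoprime (2 ^ 4) z :=
    isCoprime_one_left.of_isCoprime_of_dvd_left h16.dvd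
  refine ⟨(X ^ (2 * d) + 4) ^ 2, 2 ^ 4, ⟨(isCoprime_sixteen _).symm, ?_, ?_⟩, ?_, ?_⟩
  · rw [show ((X ^ (2 * d) + 4) ^ 2 : F[X]) = 2 ^ 4 + X ^ (2 * d) * (X ^ (2 * d) + 8) by ring]
    exact (isCoprime_sixteen _).add_mul_left_left _
  · rw [show ((X ^ (2 * d) + 4) ^ 2 - 8 * 2 ^ 4 : F[X]) =
      2 ^ 4 + (X ^ (2 * d) + 16) * (X ^ (2 * d) - 8) by ring]
    exact (isCoprime_sixteen _).add_mul_left_left _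
  · have hdeg : (X ^ (2 * d) + 4 : F[X]).natDegree = 2 * d := natDegree_X_pow_add_C (r := (4 : F))
    rw [natDegree_eq_zero_of_isUnit h16, natDegree_X_pow, natDegree_pow, hdeg]
    lia
  · simpa only [map_pow, map_add, map_ofNat, RatFunc.algebraMap_X] using
      hasXCoord_four_nsmul_pointP hF hd

end CurveE

theorem corollary1p6_general {F : Type*} [Field F] (hF : ringChar F ≠ 2)
    [DecidableEq (RatFunc F)] (d : ℕ) (hd : 1 ≤ d) :
    ¬ IsOfFinAddOrder (pointP hF hd) ∧
      0 < Module.rank ℤ (curveE F d).toAffine.Point := by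
  have h4P : ¬ IsOfFinAddOrder (4 • pointP hF hd) :=
    not_isOfFinAddOrder_of_lt_two_nsmul {Q | ReducesNonsingularly Q} xHeight
      (fun _ hQ ↦ ReducesNonsingularly.two_nsmul hF hQ)
      (reducesNonsingularly_four_nsmul_pointP hF hd)
  have hP : ¬ IsOfFinAddOrder (pointP hF hd) := fun h ↦ h4P h.nsmul
  exact ⟨hP, rank_int_pos_of_not_isOfFinAddOrder hP⟩

theorem corollary1p6 {F : Type*} [Field F] [Finite F] (hF : ringChar F ≠ 2)
    [DecidableEq (RatFunc F)] (d : ℕ) (hd : 1 ≤ d) :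
    ¬ IsOfFinAddOrder (pointP hF hd) ∧
      0 < Module.rank ℤ (curveE F d).toAffine.Point :=
  corollary1p6_general hF d hd
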